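/- Theorem 2.1. Let $m$ be a nonnegative integer. For a positive semidefinite complex $m\times m$ matrix $A$ let $\lambda_1(A)\ge\dots\ge\lambda_m(A)$ be its eigenvalues and, for any complex $m\times m$ matrix $X$, let $s_1(X)\ge\dots\ge s_m(X)$ be its singular values, both counted with multiplicity; write $\lambda(A)=(\lambda_i(A))_{i=1}^m$ and $s(X)=(s_i(X))_{i=1}^m$. For $a,b\in[0,\infty)^m$ with decreasing rearrangements $a^\downarrow,b^\downarrow$, write $a\prec_{\log}b$ if $\prod_{i=1}^k a_i^\downarrow\le\prod_{i=1}^k b_i^\downarrow$ for $1\le k\le m-1$ and $\prod_{i=1}^m a_i=\prod_{i=1}^m b_i$. Let $A_1,A_2,B_1,B_2$ be positive semidefinite complex $m\times m$ matrices with $A_1A_2=A_2A_1$ and $B_1B_2=B_2B_1$, and let $\theta\in[0,1]$. Adopt throughout either one of the following two conventions (they matter only for $\theta\in\{0,1\}$): (i) $A^0=I$ for positive semidefinite matrices $A$, and $0^0=1$ for scalars; (ii) $A^0$ is the support projection of $A$ (the orthogonal projection onto its range), and $0^0=0$ for scalars. Then $A_1^\theta A_2^{1-\theta}$ and $B_1^\theta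 B_2^{1-\theta}$ are positive semidefinite and $$\lambda\Bigl(\bigl(A_1^\theta A_2^{1-\theta}\bigr)^{1/2}\bigl(B_1^\theta B_2^{1-\theta}\bigr)\bigl(A_1^\theta A_2^{1-\theta}\bigr)^{1/2}\Bigr)\prec_{\log}\Bigl(\lambda_i\bigl(A_1^{1/2}B_1A_1^{1/2}\bigr)^\theta\,\lambda_i\bigl(A_2^{1/2}B_2A_2^{1/2}\bigr)^{1-\theta}\Bigr)_{i=1}^m .$$ Equivalently (as a statement about all such matrices), $$s\Bigl(\bigl(A_1^\theta A_2^{1-\theta}\bigr)\bigl(B_1^\theta B_2^{1-\theta}\bigr)\Bigr)\prec_{\log}\Bigl(s_i(A_1B_1)^\theta\,s_i(A_2B_2)^{1-\theta}\Bigr)_{i=1}^m .$$ This extends Araki's log-majorization: for all positive semidefinite complex $m\times m$ matrices $A,B$ and all $0<p\le1$, $$\lambda\bigl(A^{p/2}B^pA^{p/2}\bigr)\prec_{\log}\lambda\bigl((A^{1/2}BA^{1/2})^p\bigr).$$ -/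

import Mathlib

open scoped MatrixOrder ComplexOrder

/-- The two conventions for zeroth powers: `one` is `A ^ 0 = I` for matrices and `0 ^ 0 = 1` for
scalars; `support` is `A ^ 0 =` the support projection of `A` for matrices and `0 ^ 0 = 0` for
scalars. -/
inductive ZeroPowConvention
  | one
  | support

/-- The support projection of a Hermitian matrix `A`: its spectral projection for the nonzero
eigenvalues, that is, the orthogonal projection onto the range of `A`. -/
noncomputable def supportProj {m : ℕ} (A : Matrix (Fin m) (Fin m) ℂ) :
    Matrix (Fin m) (Fin m) ℂ :=
  cfc (fun x : ℝ => if x = 0 then 0 else 1) A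

/-- The power `A ^ t` of a positive semidefinite matrix for `0 ≤ t`. Only the value
at `t = 0` depends on the convention. -/
noncomputable def matPow (c : ZeroPowConvention) {m : ℕ} (A : Matrix (Fin m) (Fin m) ℂ) (t : ℝ) :
    Matrix (Fin m) (Fin m) ℂ :=
  match c with
  | .one => A ^ t
  | .support => if t = 0 then supportProj A else A ^ t

/-- The power `x ^ t` of a scalar `0 ≤ x` for `0 ≤ t`. Only the value of `0 ^ 0`
depends on the convention. -/
noncomputable def scalarPow (c : ZeroPowConvention) (x t : ℝ) : ℝ :=
  match c with
  | .one => x ^ t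
  | .support => if x = 0 ∧ t = 0 then 0 else x ^ t

open Classical in
/-- The eigenvalues of a Hermitian matrix, in decreasing order and counted with multiplicity
(with the dummy value `0` for matrices that are not Hermitian). -/
noncomputable def eigVec {m : ℕ} (A : Matrix (Fin m) (Fin m) ℂ) : Fin m → ℝ := fun i =>
  if h : A.IsHermitian then h.eigenvalues₀ (Fin.cast (Fintype.card_fin m).symm i) else 0

/-- The singular values of a matrix, in decreasing order and counted with multiplicity. -/
noncomputable def singVec {m : ℕ} (X : Matrix (Fin m) (Fin m) ℂ) : Fin m → ℝ := fun i =>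
  (Matrix.toEuclideanLin X).singularValues (i : ℕ)

/-- The decreasing rearrangement of a real vector. -/
noncomputable def decr {m : ℕ} (a : Fin m → ℝ) : Fin m → ℝ :=
  a ∘ Tuple.sort (fun i => -a i)

theorem decr_antitone {m : ℕ} (a : Fin m → ℝ) : Antitone (decr a) := fun _ _ hij =>
  neg_le_neg_iff.mp (Tuple.monotone_sort (fun i => -a i) hij)

/-- Log-majorization `a ≺_log b` of vectors with nonnegative real entries. -/
structure LogMajorizedBy {m : ℕ} (a b : Fin m → ℝ) : Prop where
  nonneg_left : ∀ i, 0 ≤ a i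
  nonneg_right : ∀ i, 0 ≤ b i
  prod_le : ∀ k : ℕ, 1 ≤ k → k < m →
    ∏ i ∈ Finset.univ.filter (fun i : Fin m => (i : ℕ) < k), decr a i ≤
      ∏ i ∈ Finset.univ.filter (fun i : Fin m => (i : ℕ) < k), decr b i
  prod_eq : ∏ i, a i = ∏ i, b i

open Matrix

/-! The proof is complex interpolation applied to `k × k` determinants. The product of the `k`
largest singular values of `X` is the maximum of `|det (Wᴴ X V)|` over `m × k` contractions `V`, `W`
(`norm_det_compression_le` and `exists_prod_singVec_le_norm_det_compression`).

For fixed `V`, `W`, put `F(z) = A₁^z A₂^(1-z) B₂^(1-z) B₁^z`, with powers vanishing on kernels. Then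
`det (Wᴴ F(z) V)` is entire and bounded on the strip `0 ≤ Re z ≤ 1`. Imaginary powers are
contractions, so `F(z)` is `A₂ B₂` between two contractions on `Re z = 0` and, by commutativity, `A₁
B₁` between two contractions on `Re z = 1`. Hadamard's three lines theorem at `z = θ` bounds the
determinant by the weighted geometric mean of the two singular value products
(`norm_det_interpFamily_le`); maximizing over `V`, `W` gives the inequalities for `s`. The full
product is an identity between determinants.

The eigenvalue form is the singular value form for the square roots, squared: `λ(R N² R) = s(N R)²`
for Hermitian `R`, `N`. Araki's case is `A₂ = B₂ = 1`, `θ = p`. -/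

/-! ### Ordered eigenvalues and singular values. -/

theorem decr_eq_self {m : ℕ} {a : Fin m → ℝ} (ha : Antitone a) : decr a = a := by
  have h : Monotone fun i => -a i := fun i j hij => neg_le_neg (ha hij)
  unfold decr
  rw [Tuple.sort_eq_refl_iff_monotone.mpr h]
  rfl

theorem eigVec_apply {m : ℕ} {A : Matrix (Fin m) (Fin m) ℂ} (hA : A.IsHermitian) (i : Fin m) :
    eigVec A i = hA.eigenvalues₀ (Fin.cast (Fintype.card_fin m).symm i) := by
  simp [eigVec, hA]

theorem eigVec_antitone {m : ℕ} (A : Matrix (Fin m) (Fin m) ℂ) : Antitone (eigVec A) := by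
  intro i j hij
  by_cases hA : A.IsHermitian
  · rw [eigVec_apply hA, eigVec_apply hA]
    exact hA.eigenvalues₀_antitone hij
  · simp [eigVec, hA]

/-- The spectral theorem with decreasingly ordered eigenvalues. -/
theorem exists_unitary_cfc_eq {m : ℕ} {A : Matrix (Fin m) (Fin m) ℂ} (hA : A.IsHermitian) :
    ∃ U : Matrix (Fin m) (Fin m) ℂ, Uᴴ * U = 1 ∧ U * Uᴴ = 1 ∧
      ∀ f : ℝ → ℝ, cfc f A = U * diagonal (fun i => (f (eigVec A i) : ℂ)) * Uᴴ := by
  -- `IsHermitian.eigenvalues` is indexed through an arbitrary equivalence; `e` undoes it, so that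
  -- the columns of the unitary follow the decreasing order.
  let e : Fin m ≃ Fin m := (finCongr (Fintype.card_fin m).symm).trans
    (Fintype.equivOfCardEq (Fintype.card_fin _))
  have he : ∀ i, hA.eigenvalues (e i) = eigVec A i := by
    intro i
    rw [eigVec_apply hA]
    simp [IsHermitian.eigenvalues, e]
  let U' : Matrix (Fin m) (Fin m) ℂ := hA.eigenvectorUnitary
  have h1 : U'ᴴ * U' = 1 := Unitary.coe_star_mul_self hA.eigenvectorUnitary
  have h2 : U' * U'ᴴ = 1 := Unitary.coe_mul_star_self hA.eigenvectorUnitary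
  refine ⟨U'.submatrix id e, ?_, ?_, fun f => ?_⟩
  · rw [conjTranspose_submatrix, ← submatrix_mul _ _ _ _ _ Function.bijective_id, h1]
    simp
  · rw [conjTranspose_submatrix, ← submatrix_mul _ _ _ _ _ e.bijective, h2]
    simp
  · rw [hA.cfc_eq, IsHermitian.cfc, Unitary.conjStarAlgAut_apply]
    have : diagonal (fun i => (f (eigVec A i) : ℂ)) =
        (diagonal (RCLike.ofReal ∘ f ∘ hA.eigenvalues) : Matrix (Fin m) (Fin m) ℂ).submatrix e e := by
      rw [submatrix_diagonal_equiv]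
      congr 1
      ext i
      simp [he]
    rw [this, conjTranspose_submatrix, ← submatrix_mul _ _ _ _ _ e.bijective,
      ← submatrix_mul _ _ _ _ _ e.bijective]
    simp [U', star_eq_conjTranspose]

theorem exists_unitary_eq {m : ℕ} {A : Matrix (Fin m) (Fin m) ℂ} (hA : A.IsHermitian) :
    ∃ U : Matrix (Fin m) (Fin m) ℂ, Uᴴ * U = 1 ∧ U * Uᴴ = 1 ∧
      A = U * diagonal (fun i => (eigVec A i : ℂ)) * Uᴴ := by
  obtain ⟨U, h1, h2, h⟩ := exists_unitary_cfc_eq hA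
  refine ⟨U, h1, h2, ?_⟩
  rw [← h fun x => x]
  exact (cfc_id' ℝ A hA).symm

theorem eigVec_nonneg {m : ℕ} {A : Matrix (Fin m) (Fin m) ℂ} (hA : A.PosSemidef) (i : Fin m) :
    0 ≤ eigVec A i := by
  rw [eigVec_apply hA.1]
  have := hA.eigenvalues_nonneg (Fintype.equivOfCardEq (Fintype.card_fin _)
    (Fin.cast (Fintype.card_fin m).symm i))
  simpa [IsHermitian.eigenvalues] using this

theorem det_unitary_conj {m : ℕ} {U : Matrix (Fin m) (Fin m) ℂ} (hU : U * Uᴴ = 1)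
    (D : Matrix (Fin m) (Fin m) ℂ) : (U * D * Uᴴ).det = D.det := by
  rw [det_mul, det_mul, mul_right_comm, ← det_mul, hU, det_one, one_mul]

theorem det_eq_prod_eigVec {m : ℕ} {A : Matrix (Fin m) (Fin m) ℂ} (hA : A.IsHermitian) :
    A.det = ∏ i, (eigVec A i : ℂ) := by
  obtain ⟨U, -, h2, h⟩ := exists_unitary_eq hA
  conv_lhs => rw [h]
  rw [det_unitary_conj h2, det_diagonal]

/-- Decreasingly ordered eigenvalues are determined by any unitary diagonalization. -/
theorem eigVec_eq_of_unitary_conj {m : ℕ} {A U : Matrix (Fin m) (Fin m) ℂ} {d : Fin m → ℝ}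
    (hd : Antitone d) (hU : U * Uᴴ = 1) (hA : A = U * diagonal (fun i => (d i : ℂ)) * Uᴴ) :
    eigVec A = d := by
  have hAH : A.IsHermitian := by
    rw [hA]
    apply isHermitian_mul_mul_conjTranspose
    apply isHermitian_diagonal_of_self_adjoint
    ext i
    simp
  have hchar : ∀ (V : Matrix (Fin m) (Fin m) ℂ) (g : Fin m → ℝ), V * Vᴴ = 1 →
      A = V * diagonal (fun i => (g i : ℂ)) * Vᴴ →
      A.charpoly.roots = (List.ofFn g : Multiset ℝ).map (fun x : ℝ => (x : ℂ)) := by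
    intro V g hV hA
    rw [hA, charpoly_mul_comm, ← mul_assoc, mul_eq_one_comm.mp hV, one_mul, charpoly_diagonal]
    rw [Polynomial.roots_prod]
    · simp only [Polynomial.roots_X_sub_C]
      rw [Multiset.bind_singleton]
      simp only [Multiset.map_coe, List.map_ofFn]
      rw [Fin.univ_val_map]
      rfl
    · exact Finset.prod_ne_zero_iff.mpr fun i _ => Polynomial.X_sub_C_ne_zero _
  obtain ⟨V, -, hV, hAV⟩ := exists_unitary_eq hAH
  have h := (hchar V _ hV hAV).symm.trans (hchar U d hU hA)
  have h' := Multiset.map_injective Complex.ofReal_injective h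
  have hp : (List.ofFn (eigVec A)).Perm (List.ofFn d) := Multiset.coe_eq_coe.mp h'
  have hl : List.ofFn (eigVec A) = List.ofFn d := by
    refine hp.eq_of_pairwise' (r := (· ≥ ·)) ?_ ?_
    · exact List.pairwise_ofFn.mpr fun i j hij => eigVec_antitone A hij.le
    · exact List.pairwise_ofFn.mpr fun i j hij => hd hij.le
  exact List.ofFn_injective hl

theorem eigVec_cfc {m : ℕ} {A : Matrix (Fin m) (Fin m) ℂ} (hA : A.PosSemidef) {f : ℝ → ℝ}
    (hf : MonotoneOn f (Set.Ici 0)) : eigVec (cfc f A) = fun i => f (eigVec A i) := by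
  obtain ⟨U, -, h2, h⟩ := exists_unitary_cfc_eq hA.1
  exact eigVec_eq_of_unitary_conj
    (fun i j hij => hf (eigVec_nonneg hA j) (eigVec_nonneg hA i) (eigVec_antitone A hij)) h2 (h f)

theorem eigenvalues_congr {E : Type*} [NormedAddCommGroup E] [InnerProductSpace ℂ E]
    [FiniteDimensional ℂ E] {n n' : ℕ} (h : n = n') {S T : E →ₗ[ℂ] E} (hST : S = T)
    (hS : S.IsSymmetric) (hT : T.IsSymmetric) (hn : Module.finrank ℂ E = n)
    (hn' : Module.finrank ℂ E = n') (i : Fin n) :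
    hS.eigenvalues hn i = hT.eigenvalues hn' (Fin.cast h i) := by
  subst h hST
  rfl

theorem singVec_eq_sqrt {m : ℕ} (X : Matrix (Fin m) (Fin m) ℂ) (i : Fin m) :
    singVec X i = √(eigVec (Xᴴ * X) i) := by
  have hH : (Xᴴ * X).IsHermitian := isHermitian_conjTranspose_mul_self X
  have hlin : LinearMap.adjoint (toEuclideanLin X) ∘ₗ toEuclideanLin X
      = toEuclideanLin (Xᴴ * X) := by
    rw [← Matrix.toEuclideanLin_conjTranspose_eq_adjoint]
    ext v
    simp [toEuclideanLin, toLpLin, mulVec_mulVec]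
  unfold singVec
  rw [LinearMap.singularValues_fin (n := m) _ (by simp), eigVec_apply hH]
  congr 1
  exact eigenvalues_congr (Fintype.card_fin m).symm hlin _ _ _ _ i

theorem singVec_nonneg {m : ℕ} (X : Matrix (Fin m) (Fin m) ℂ) (i : Fin m) : 0 ≤ singVec X i :=
  LinearMap.singularValues_nonneg _ _

theorem singVec_antitone {m : ℕ} (X : Matrix (Fin m) (Fin m) ℂ) : Antitone (singVec X) :=
  fun _ _ hij => LinearMap.singularValues_antitone _ hij

theorem sq_singVec {m : ℕ} (X : Matrix (Fin m) (Fin m) ℂ) (i : Fin m) :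
    singVec X i ^ 2 = eigVec (Xᴴ * X) i := by
  rw [singVec_eq_sqrt, Real.sq_sqrt (eigVec_nonneg (posSemidef_conjTranspose_mul_self X) i)]

theorem prod_singVec {m : ℕ} (X : Matrix (Fin m) (Fin m) ℂ) : ∏ i, singVec X i = ‖X.det‖ := by
  have h : (∏ i, singVec X i) ^ 2 = ‖X.det‖ ^ 2 := by
    have h1 := det_eq_prod_eigVec (isHermitian_conjTranspose_mul_self X)
    rw [det_mul, det_conjTranspose] at h1
    have h2 : ((‖X.det‖ ^ 2 : ℝ) : ℂ) = star X.det * X.det := by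
      rw [mul_comm]; simp [Complex.mul_conj']
    rw [← h2] at h1
    rw [← Finset.prod_pow]
    simp_rw [sq_singVec]
    exact_mod_cast h1.symm
  exact (sq_eq_sq₀ (Finset.prod_nonneg fun i _ => singVec_nonneg X i) (norm_nonneg _)).mp h

/-! ### Determinant monotonicity and contractions. -/

theorem one_le_det_one_add {n : ℕ} {P : Matrix (Fin n) (Fin n) ℂ} (hP : P.PosSemidef) :
    1 ≤ (1 + P).det := by
  obtain ⟨U, -, h2, h⟩ := exists_unitary_eq hP.1
  have : 1 + P = U * diagonal (fun i => ((1 + eigVec P i : ℝ) : ℂ)) * Uᴴ := by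
    have hd : diagonal (fun i => ((1 + eigVec P i : ℝ) : ℂ)) =
        1 + diagonal (fun i => (eigVec P i : ℂ)) := by
      rw [← diagonal_one, diagonal_add]; simp
    rw [hd, Matrix.mul_add, Matrix.add_mul, ← h, Matrix.mul_one, h2]
  rw [this, det_unitary_conj h2, det_diagonal, ← Complex.ofReal_prod]
  have : 1 ≤ ∏ i, (1 + eigVec P i) :=
    Finset.prod_le_prod (f := 1) (by simp) (fun i _ => by simpa using eigVec_nonneg hP i) |>.trans' (by simp)
  exact_mod_cast this

/-- If `A = Sᴴ S` is invertible, then `B = Sᴴ (1 + P) S` with `P` positive semidefinite, and `det (1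
+ P) ≥ 1`. If `A` is singular, only `det B ≥ 0` is needed. -/
theorem det_le_det_of_posSemidef_sub {n : ℕ} {A B : Matrix (Fin n) (Fin n) ℂ} (hA : A.PosSemidef)
    (hAB : (B - A).PosSemidef) : A.det ≤ B.det := by
  by_cases h0 : A.det = 0
  · rw [h0]
    have : B.PosSemidef := by simpa using hAB.add hA
    exact this.det_nonneg
  obtain ⟨S, rfl⟩ := CStarAlgebra.nonneg_iff_eq_star_mul_self.mp hA.nonneg
  rw [star_eq_conjTranspose] at *
  have hS : S.det ≠ 0 := fun h => h0 (by rw [det_mul, h, mul_zero])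
  have hu : IsUnit S.det := hS.isUnit
  have h1 : S⁻¹ * S = 1 := nonsing_inv_mul _ hu
  have h1' : Sᴴ * (S⁻¹)ᴴ = 1 := by rw [← conjTranspose_mul, h1, conjTranspose_one]
  have hB : B = Sᴴ * (1 + (S⁻¹)ᴴ * (B - Sᴴ * S) * S⁻¹) * S := by
    have : Sᴴ * ((S⁻¹)ᴴ * (B - Sᴴ * S) * S⁻¹) * S =
        (Sᴴ * (S⁻¹)ᴴ) * (B - Sᴴ * S) * (S⁻¹ * S) := by simp only [Matrix.mul_assoc]
    rw [Matrix.mul_add, Matrix.add_mul, this, h1, h1']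
    simp
  have h2 := one_le_det_one_add (hAB.conjTranspose_mul_mul_same S⁻¹)
  have h3 : B.det = (Sᴴ * S).det * (1 + (S⁻¹)ᴴ * (B - Sᴴ * S) * S⁻¹).det := by
    conv_lhs => rw [hB]
    rw [det_mul, det_mul, det_mul, mul_right_comm]
  rw [h3]
  exact le_mul_of_one_le_right hA.det_nonneg h2

/-- A matrix of operator norm at most one. -/
def IsContraction {p q : ℕ} (V : Matrix (Fin p) (Fin q) ℂ) : Prop :=
  (1 - Vᴴ * V).PosSemidef

namespace IsContraction

variable {p q r : ℕ}

theorem of_isometry {V : Matrix (Fin p) (Fin q) ℂ} (h : Vᴴ * V = 1) : IsContraction V := by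
  unfold IsContraction
  rw [h, sub_self]
  exact PosSemidef.zero

theorem zero : IsContraction (0 : Matrix (Fin p) (Fin q) ℂ) := by
  unfold IsContraction
  simpa using PosSemidef.one

theorem mul {C : Matrix (Fin p) (Fin q) ℂ} {V : Matrix (Fin q) (Fin r) ℂ}
    (hC : IsContraction C) (hV : IsContraction V) : IsContraction (C * V) := by
  unfold IsContraction at *
  have : 1 - (C * V)ᴴ * (C * V) = (1 - Vᴴ * V) + Vᴴ * (1 - Cᴴ * C) * V := by
    rw [conjTranspose_mul, Matrix.mul_sub, Matrix.sub_mul]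
    simp [Matrix.mul_assoc]
  rw [this]
  exact hV.add (hC.conjTranspose_mul_mul_same V)

/-- `1 - Vᴴ V` and `1 - V Vᴴ` are the two Schur complements of the block matrix with identity
diagonal blocks and off-diagonal blocks `V`, `Vᴴ`. -/
theorem one_sub_mul_conjTranspose {V : Matrix (Fin p) (Fin q) ℂ} (hV : IsContraction V) :
    (1 - V * Vᴴ).PosSemidef := by
  let _ : Invertible (1 : Matrix (Fin p) (Fin p) ℂ) := invertibleOne
  let _ : Invertible (1 : Matrix (Fin q) (Fin q) ℂ) := invertibleOne
  have h1 := _root_.Matrix.PosDef.fromBlocks₁₁ (A := (1 : Matrix (Fin p) (Fin p) ℂ)) V 1 PosDef.one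
  have h2 := _root_.Matrix.PosDef.fromBlocks₂₂ (1 : Matrix (Fin p) (Fin p) ℂ) V
    (D := (1 : Matrix (Fin q) (Fin q) ℂ)) PosDef.one
  simp only [inv_one, Matrix.mul_one] at h1 h2
  exact h2.mp (h1.mpr hV)

theorem conjTranspose {V : Matrix (Fin p) (Fin q) ℂ} (hV : IsContraction V) :
    IsContraction Vᴴ := by
  unfold IsContraction
  rw [conjTranspose_conjTranspose]
  exact hV.one_sub_mul_conjTranspose

end IsContraction

/-! ### Variational description of products of singular values. -/

theorem prod_castLE {M : Type*} [CommMonoid M] {k m : ℕ} (hk : k ≤ m) (f : Fin m → M) :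
    ∏ i : Fin k, f (Fin.castLE hk i) =
      ∏ i ∈ Finset.univ.filter (fun i : Fin m => (i : ℕ) < k), f i := by
  refine Finset.prod_bij (fun i _ => Fin.castLE hk i) ?_ ?_ ?_ ?_
  · simp
  · intro i _ j _ h
    simpa using h
  · intro j hj
    exact ⟨⟨j, by simpa using hj⟩, by simp, by simp⟩
  · simp

theorem posSemidef_diagonal_ofReal {m : ℕ} {d : Fin m → ℝ} (hd : ∀ i, 0 ≤ d i) :
    (diagonal fun i => (d i : ℂ)).PosSemidef :=
  PosSemidef.diagonal fun i => by simpa using hd i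

/-- With `G² = max(D, 1) - 1`, the bounds `D ≤ 1 + G²` and `Vᴴ V ≤ 1` give `Vᴴ D V ≤ 1 + (G V)ᴴ (G
V)`. Sylvester's identity turns the determinant of the right side into that of `1 + G V Vᴴ G`, and
`V Vᴴ ≤ 1` bounds this by `det (1 + G²)`. -/
theorem det_compression_diagonal_le_prod_max {k m : ℕ} {V : Matrix (Fin m) (Fin k) ℂ}
    (hV : IsContraction V) {d : Fin m → ℝ} (hd : ∀ i, 0 ≤ d i) :
    (Vᴴ * diagonal (fun i => (d i : ℂ)) * V).det ≤ ((∏ i, max (d i) 1 : ℝ) : ℂ) := by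
  let g : Fin m → ℝ := fun i => √(max (d i) 1 - 1)
  have hg : ∀ i, g i * g i = max (d i) 1 - 1 := fun i =>
    Real.mul_self_sqrt (sub_nonneg.mpr (le_max_right _ _))
  let G : Matrix (Fin m) (Fin m) ℂ := diagonal fun i => (g i : ℂ)
  have hGH : Gᴴ = G := by
    simp only [G, diagonal_conjTranspose]
    congr 1
    ext i
    simp
  have hGG : G * G = diagonal (fun i => ((max (d i) 1 - 1 : ℝ) : ℂ)) := by
    simp only [G, diagonal_mul_diagonal]
    congr 1
    ext i
    rw [← Complex.ofReal_mul, hg]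
  have h1 : (1 + G * G - diagonal (fun i => (d i : ℂ))).PosSemidef := by
    rw [hGG, ← diagonal_one, diagonal_add, diagonal_sub]
    have := posSemidef_diagonal_ofReal (m := m) (d := fun i => max (d i) 1 - d i)
      (fun i => sub_nonneg.mpr (le_max_left _ _))
    have heq : ∀ i, (1 : ℂ) + ((max (d i) 1 - 1 : ℝ) : ℂ) - (d i : ℂ) =
        ((max (d i) 1 - d i : ℝ) : ℂ) := fun i => by push_cast; ring
    simpa only [heq] using this
  have h2 : (Vᴴ * diagonal (fun i => (d i : ℂ)) * V).det ≤ (1 + (G * V)ᴴ * (G * V)).det := by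
    apply det_le_det_of_posSemidef_sub
      ((posSemidef_diagonal_ofReal hd).conjTranspose_mul_mul_same V)
    have : 1 + (G * V)ᴴ * (G * V) - Vᴴ * diagonal (fun i => (d i : ℂ)) * V =
        (1 - Vᴴ * V) + Vᴴ * (1 + G * G - diagonal (fun i => (d i : ℂ))) * V := by
      rw [conjTranspose_mul, hGH]
      simp only [Matrix.mul_add, Matrix.add_mul, Matrix.mul_sub, Matrix.sub_mul, Matrix.mul_one, Matrix.mul_assoc]
      abel
    rw [this]
    exact PosSemidef.add hV (h1.conjTranspose_mul_mul_same V)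
  have h3 : (1 + (G * V)ᴴ * (G * V)).det ≤ (1 + G * G).det := by
    rw [det_one_add_mul_comm]
    refine det_le_det_of_posSemidef_sub
      (PosSemidef.one.add (posSemidef_self_mul_conjTranspose (G * V))) ?_
    have : 1 + G * G - (1 + G * V * (G * V)ᴴ) = Gᴴ * (1 - V * Vᴴ) * G := by
      rw [conjTranspose_mul, hGH]
      simp only [Matrix.mul_sub, Matrix.sub_mul, Matrix.mul_one, Matrix.mul_assoc]
      abel
    rw [this]
    exact hV.one_sub_mul_conjTranspose.conjTranspose_mul_mul_same G
  have h4 : (1 + G * G).det = ((∏ i, max (d i) 1 : ℝ) : ℂ) := by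
    rw [hGG, ← diagonal_one, diagonal_add, det_diagonal]
    push_cast
    simp
  exact (h2.trans h3).trans_eq h4

/-- The determinant of a `k`-dimensional compression of a nonnegative diagonal matrix is at most
the product of the `k` largest diagonal entries. -/
theorem det_compression_diagonal_le {k m : ℕ} (hk : k ≤ m) (hk0 : 0 < k)
    {V : Matrix (Fin m) (Fin k) ℂ} (hV : IsContraction V) {d : Fin m → ℝ} (hd : ∀ i, 0 ≤ d i)
    (hanti : Antitone d) :
    (Vᴴ * diagonal (fun i => (d i : ℂ)) * V).det ≤ ((∏ i, d (Fin.castLE hk i) : ℝ) : ℂ) := by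
  obtain ⟨hre, him⟩ := Complex.nonneg_iff.mp
    ((posSemidef_diagonal_ofReal hd).conjTranspose_mul_mul_same V).det_nonneg
  rw [Complex.le_def]
  refine ⟨?_, by rw [← him, Complex.ofReal_im]⟩
  rw [Complex.ofReal_re]
  -- This is the `k`-th largest entry. For `c > c₀`, the previous bound applied to `d / c` has
  -- trivial factors beyond the first `k`, and `c ^ k` restores the scale. Strict inequality keeps
  -- `c` positive even if `c₀ = 0`; then `c` decreases to `c₀`.
  let c₀ : ℝ := d ⟨k - 1, by omega⟩
  have hc₀ : 0 ≤ c₀ := hd _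
  have key : ∀ c : ℝ, c₀ < c → (Vᴴ * diagonal (fun i => (d i : ℂ)) * V).det.re ≤
      ∏ i, max (d (Fin.castLE hk i)) c := by
    intro c hc
    have hcpos : 0 < c := hc₀.trans_lt hc
    have h1 := (Complex.le_def.mp (det_compression_diagonal_le_prod_max hV
      (d := fun i => d i / c) (fun i => div_nonneg (hd i) hcpos.le))).1
    have h2 : Vᴴ * diagonal (fun i => (d i : ℂ)) * V =
        (c : ℂ) • (Vᴴ * diagonal (fun i => ((d i / c : ℝ) : ℂ)) * V) := by
      rw [← Matrix.smul_mul, ← Matrix.mul_smul, ← diagonal_smul]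
      congr 3
      ext i
      have : (c : ℂ) ≠ 0 := by exact_mod_cast hcpos.ne'
      simp
      field_simp
    rw [Complex.ofReal_re] at h1
    have h3 : ∏ i, max (d i / c) 1 = ∏ i : Fin k, max (d (Fin.castLE hk i) / c) 1 := by
      rw [prod_castLE hk fun i => max (d i / c) 1, Finset.prod_filter]
      refine Finset.prod_congr rfl fun i _ => ?_
      split_ifs with hi
      · rfl
      · apply max_eq_right
        rw [div_le_one hcpos]
        refine le_trans (hanti ?_) hc.le
        rw [Fin.le_def]
        simp
        omega
    rw [h2, det_smul, Fintype.card_fin, ← Complex.ofReal_pow, Complex.re_ofReal_mul]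
    calc _ ≤ c ^ k * ∏ i : Fin k, max (d (Fin.castLE hk i) / c) 1 := by
          rw [← h3]
          gcongr
      _ = ∏ i, max (d (Fin.castLE hk i)) c := by
          rw [← Fin.prod_const, ← Finset.prod_mul_distrib]
          refine Finset.prod_congr rfl fun i _ => ?_
          rw [mul_max_of_nonneg _ _ hcpos.le, mul_div_cancel₀ _ hcpos.ne', mul_one]
  have hcont : Continuous fun c : ℝ => ∏ i, max (d (Fin.castLE hk i)) c := by fun_prop
  have hlim := (hcont.tendsto c₀).mono_left (nhdsWithin_le_nhds (s := Set.Ioi c₀))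
  have heq : ∏ i, max (d (Fin.castLE hk i)) c₀ = ∏ i, d (Fin.castLE hk i) := by
    refine Finset.prod_congr rfl fun i _ => max_eq_left (hanti ?_)
    rw [Fin.le_def]
    simp
    omega
  rw [heq] at hlim
  exact ge_of_tendsto hlim (Filter.eventually_of_mem self_mem_nhdsWithin key)

/-- Compressions of `X` by contractions have determinant at most the product of the largest
singular values of `X`. -/
theorem norm_det_compression_le {k m : ℕ} (hk : k ≤ m) (hk0 : 0 < k)
    {V W : Matrix (Fin m) (Fin k) ℂ} (hV : IsContraction V) (hW : IsContraction W)
    (X : Matrix (Fin m) (Fin m) ℂ) :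
    ‖(Wᴴ * X * V).det‖ ≤ ∏ i, singVec X (Fin.castLE hk i) := by
  have hpos := posSemidef_conjTranspose_mul_self X
  obtain ⟨U, h1, h2, hU⟩ := exists_unitary_eq hpos.1
  have h3 : ((Wᴴ * X * V)ᴴ * (Wᴴ * X * V)).det ≤ (Vᴴ * (Xᴴ * X) * V).det := by
    refine det_le_det_of_posSemidef_sub (posSemidef_conjTranspose_mul_self _) ?_
    have : Vᴴ * (Xᴴ * X) * V - (Wᴴ * X * V)ᴴ * (Wᴴ * X * V) =
        (X * V)ᴴ * (1 - W * Wᴴ) * (X * V) := by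
      simp only [conjTranspose_mul, conjTranspose_conjTranspose, Matrix.mul_sub, Matrix.sub_mul, Matrix.mul_one,
        Matrix.mul_assoc]
    rw [this]
    exact hW.one_sub_mul_conjTranspose.conjTranspose_mul_mul_same _
  have h4 : Vᴴ * (Xᴴ * X) * V =
      (Uᴴ * V)ᴴ * diagonal (fun i => (eigVec (Xᴴ * X) i : ℂ)) * (Uᴴ * V) := by
    conv_lhs => rw [hU]
    simp only [conjTranspose_mul, conjTranspose_conjTranspose, Matrix.mul_assoc]
  have hUV : IsContraction (Uᴴ * V) :=
    (IsContraction.of_isometry (by rwa [conjTranspose_conjTranspose])).mul hV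
  have h5 := det_compression_diagonal_le hk hk0 hUV (eigVec_nonneg hpos) (eigVec_antitone _)
  rw [← h4] at h5
  have h6 := h3.trans h5
  rw [det_mul, det_conjTranspose] at h6
  have h7 : star (Wᴴ * X * V).det * (Wᴴ * X * V).det = ((‖(Wᴴ * X * V).det‖ ^ 2 : ℝ) : ℂ) := by
    rw [mul_comm]; simp [Complex.mul_conj']
  rw [h7, Complex.real_le_real] at h6
  simp_rw [← sq_singVec, Finset.prod_pow] at h6
  exact le_of_sq_le_sq h6 (Finset.prod_nonneg fun i _ => singVec_nonneg X _)

/-- The columns of `V` are the top `k` right singular vectors and those of `W = X V diag(1/s)` the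
matching left ones, so the compression is `diag(s)`. If the product vanishes, zero matrices suffice.
-/
theorem exists_prod_singVec_le_norm_det_compression {k m : ℕ} (hk : k ≤ m)
    (X : Matrix (Fin m) (Fin m) ℂ) :
    ∃ V W : Matrix (Fin m) (Fin k) ℂ, IsContraction V ∧ IsContraction W ∧
      ∏ i, singVec X (Fin.castLE hk i) ≤ ‖(Wᴴ * X * V).det‖ := by
  by_cases h0 : ∏ i, singVec X (Fin.castLE hk i) = 0
  · exact ⟨0, 0, .zero, .zero, h0.le.trans (norm_nonneg _)⟩
  have hs : ∀ i, singVec X (Fin.castLE hk i) ≠ 0 := fun i =>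
    Finset.prod_ne_zero_iff.mp h0 i (Finset.mem_univ i)
  obtain ⟨U, h1, h2, hU⟩ := exists_unitary_eq (isHermitian_conjTranspose_mul_self X)
  let s : Fin k → ℂ := fun i => (singVec X (Fin.castLE hk i) : ℂ)
  have hs' : ∀ i, s i ≠ 0 := fun i => Complex.ofReal_ne_zero.mpr (hs i)
  let V : Matrix (Fin m) (Fin k) ℂ := U.submatrix id (Fin.castLE hk)
  have hinj : Function.Injective (Fin.castLE hk) := Fin.castLE_injective hk
  have hV : Vᴴ * V = 1 := by
    rw [conjTranspose_submatrix, ← submatrix_mul _ _ _ _ _ Function.bijective_id, h1,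
      submatrix_one _ hinj]
  have hVX : Vᴴ * (Xᴴ * X) * V = diagonal fun i => s i ^ 2 := by
    have h3 : Uᴴ * (Xᴴ * X) * U = diagonal (fun i => (eigVec (Xᴴ * X) i : ℂ)) := by
      conv_lhs => rw [hU]
      calc _ = (Uᴴ * U) * diagonal (fun i => (eigVec (Xᴴ * X) i : ℂ)) * (Uᴴ * U) := by
            simp only [Matrix.mul_assoc]
        _ = _ := by rw [h1]; simp
    have h4 : Vᴴ * (Xᴴ * X) * V =
        (Uᴴ * (Xᴴ * X) * U).submatrix (Fin.castLE hk) (Fin.castLE hk) := by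
      rw [submatrix_mul _ _ _ id _ Function.bijective_id,
        submatrix_mul _ _ _ id _ Function.bijective_id, submatrix_id_id, conjTranspose_submatrix]
    rw [h4, h3, submatrix_diagonal _ _ hinj]
    congr 1
    ext i
    simp [s, ← sq_singVec]
  let E : Matrix (Fin k) (Fin k) ℂ := diagonal fun i => (s i)⁻¹
  have hE : Eᴴ = E := by
    simp only [E, diagonal_conjTranspose]
    congr 1
    ext i
    simp [s]
  have hWXV : (X * V * E)ᴴ * X * V = diagonal s := by
    calc _ = E * (Vᴴ * (Xᴴ * X) * V) := by
          simp only [conjTranspose_mul, hE, Matrix.mul_assoc]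
      _ = _ := by
          rw [hVX, diagonal_mul_diagonal]
          congr 1
          ext i
          field_simp [hs' i]
  refine ⟨V, X * V * E, .of_isometry hV, .of_isometry ?_, ?_⟩
  · rw [← Matrix.mul_assoc, ← Matrix.mul_assoc, hWXV, diagonal_mul_diagonal, ← diagonal_one]
    congr 1
    ext i
    exact mul_inv_cancel₀ (hs' i)
  · rw [hWXV, det_diagonal, norm_prod]
    refine Finset.prod_le_prod (fun i _ => singVec_nonneg X _) fun i _ => ?_
    simp [s, le_abs_self]

/-! ### Real powers under the two conventions. -/

theorem matPow_eq_cfc (c : ZeroPowConvention) {m : ℕ} {A : Matrix (Fin m) (Fin m) ℂ}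
    (hA : A.PosSemidef) (t : ℝ) : matPow c A t = cfc (fun x => scalarPow c x t) A := by
  have hpow : A ^ t = cfc (fun x : ℝ => x ^ t) A := CFC.rpow_eq_cfc_real hA.nonneg
  cases c with
  | one => exact hpow
  | support =>
    by_cases ht : t = 0
    · subst ht
      simp [matPow, scalarPow, supportProj]
    · simp [matPow, scalarPow, ht, hpow]

theorem scalarPow_nonneg (c : ZeroPowConvention) {x : ℝ} (hx : 0 ≤ x) (t : ℝ) :
    0 ≤ scalarPow c x t := by
  cases c with
  | one => exact Real.rpow_nonneg hx t
  | support =>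
    simp only [scalarPow]
    split_ifs
    · exact le_rfl
    · exact Real.rpow_nonneg hx t

theorem scalarPow_mul (c : ZeroPowConvention) {x y : ℝ} (hx : 0 ≤ x) (hy : 0 ≤ y) (t : ℝ) :
    scalarPow c (x * y) t = scalarPow c x t * scalarPow c y t := by
  cases c with
  | one => exact Real.mul_rpow hx hy
  | support =>
    by_cases ht : t = 0
    · subst ht
      by_cases h1 : x = 0 <;> by_cases h2 : y = 0 <;> simp [scalarPow, h1, h2]
    · simp [scalarPow, ht, Real.mul_rpow hx hy]

theorem scalarPow_one_left (c : ZeroPowConvention) (t : ℝ) : scalarPow c 1 t = 1 := by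
  cases c <;> simp [scalarPow]

theorem scalarPow_one_right (c : ZeroPowConvention) (x : ℝ) : scalarPow c x 1 = x := by
  cases c <;> simp [scalarPow]

theorem scalarPow_prod (c : ZeroPowConvention) {ι : Type*} (s : Finset ι) {f : ι → ℝ}
    (hf : ∀ i, 0 ≤ f i) (t : ℝ) : scalarPow c (∏ i ∈ s, f i) t = ∏ i ∈ s, scalarPow c (f i) t := by
  classical
  induction s using Finset.induction_on with
  | empty => simp [scalarPow_one_left]
  | insert a s ha ih =>
    rw [Finset.prod_insert ha, Finset.prod_insert ha,
      scalarPow_mul c (hf a) (Finset.prod_nonneg fun i _ => hf i), ih]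

theorem scalarPow_monotoneOn (c : ZeroPowConvention) {t : ℝ} (ht : 0 ≤ t) :
    MonotoneOn (fun x => scalarPow c x t) (Set.Ici 0) := by
  intro x hx y hy hxy
  cases c with
  | one => exact Real.rpow_le_rpow hx hxy ht
  | support =>
    by_cases h : x = 0 ∧ t = 0
    · simpa [scalarPow, h] using scalarPow_nonneg .support hy 0
    · have h' : ¬ (y = 0 ∧ t = 0) := fun h' => h ⟨le_antisymm (h'.1 ▸ hxy) hx, h'.2⟩
      simpa [scalarPow, h, h'] using Real.rpow_le_rpow hx hxy ht

theorem posSemidef_matPow {c : ZeroPowConvention} {m : ℕ} {A : Matrix (Fin m) (Fin m) ℂ}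
    (hA : A.PosSemidef) (t : ℝ) : (matPow c A t).PosSemidef := by
  rw [matPow_eq_cfc c hA, ← nonneg_iff_posSemidef]
  exact cfc_nonneg fun x hx => scalarPow_nonneg c (spectrum_nonneg_of_nonneg hA.nonneg hx) t

theorem commute_matPow {c : ZeroPowConvention} {m : ℕ} {A B : Matrix (Fin m) (Fin m) ℂ}
    (hA : A.PosSemidef) (hB : B.PosSemidef) (h : Commute A B) (s t : ℝ) :
    Commute (matPow c A s) (matPow c B t) := by
  rw [matPow_eq_cfc c hA, matPow_eq_cfc c hB]
  exact ((h.cfc_real _).symm.cfc_real _).symm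

theorem posSemidef_matPow_mul_matPow {c : ZeroPowConvention} {m : ℕ}
    {A B : Matrix (Fin m) (Fin m) ℂ} (hA : A.PosSemidef) (hB : B.PosSemidef) (h : Commute A B)
    (s t : ℝ) : (matPow c A s * matPow c B t).PosSemidef :=
  (Commute.mul_nonneg (posSemidef_matPow hA s).nonneg (posSemidef_matPow hB t).nonneg
    (commute_matPow hA hB h s t)).posSemidef

/-! ### Complex powers. -/

/-- The complex power `x ^ z` of a nonnegative number, with value `0` at `x = 0`. -/
noncomputable def zeroCpow (x : ℝ) (z : ℂ) : ℂ :=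
  if x = 0 then 0 else Complex.exp (z * Real.log x)

theorem zeroCpow_add (x : ℝ) (z w : ℂ) : zeroCpow x (z + w) = zeroCpow x z * zeroCpow x w := by
  unfold zeroCpow
  split_ifs
  · simp
  · rw [add_mul, Complex.exp_add]

theorem zeroCpow_ofReal {x : ℝ} (hx : 0 ≤ x) (t : ℝ) :
    zeroCpow x t = (scalarPow .support x t : ℂ) := by
  unfold zeroCpow scalarPow
  by_cases h : x = 0
  · by_cases ht : t = 0 <;> simp [h, ht]
  · simp only [h, if_false, false_and]
    rw [Real.rpow_def_of_pos (lt_of_le_of_ne hx (Ne.symm h))]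
    push_cast
    rw [mul_comm]

theorem norm_zeroCpow_le_one (x : ℝ) {z : ℂ} (hz : z.re = 0) : ‖zeroCpow x z‖ ≤ 1 := by
  unfold zeroCpow
  split_ifs
  · simp
  · rw [Complex.norm_exp]
    simp [hz]

theorem norm_zeroCpow_le (x : ℝ) {z : ℂ} (h0 : 0 ≤ z.re) (h1 : z.re ≤ 1) :
    ‖zeroCpow x z‖ ≤ Real.exp |Real.log x| := by
  unfold zeroCpow
  split_ifs
  · simpa using Real.exp_nonneg _
  · rw [Complex.norm_exp, Real.exp_le_exp]
    simp only [Complex.mul_re, Complex.ofReal_re, Complex.ofReal_im, mul_zero, sub_zero]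
    calc _ ≤ |z.re * Real.log x| := le_abs_self _
      _ = z.re * |Real.log x| := by rw [abs_mul, abs_of_nonneg h0]
      _ ≤ _ := mul_le_of_le_one_left (abs_nonneg _) h1

/-- The value at `x = 0` is `0` for every `z`, including `z = 0`; this keeps the power entire in
`z`, and it is why interpolation yields the support convention. -/
theorem differentiable_zeroCpow (x : ℝ) : Differentiable ℂ (zeroCpow x) := by
  unfold zeroCpow
  split_ifs
  · exact differentiable_const _
  · fun_prop

/-- The complex power `A ^ z` of a positive semidefinite matrix, acting as `0` on the kernel
of `A`. -/
noncomputable def matCpow {m : ℕ} (A : Matrix (Fin m) (Fin m) ℂ) (z : ℂ) :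
    Matrix (Fin m) (Fin m) ℂ :=
  cfc (fun x : ℝ => (zeroCpow x z).re) A + Complex.I • cfc (fun x : ℝ => (zeroCpow x z).im) A

theorem exists_unitary_matCpow_eq {m : ℕ} {A : Matrix (Fin m) (Fin m) ℂ} (hA : A.IsHermitian) :
    ∃ U : Matrix (Fin m) (Fin m) ℂ, Uᴴ * U = 1 ∧ U * Uᴴ = 1 ∧
      A = U * diagonal (fun i => (eigVec A i : ℂ)) * Uᴴ ∧
      (∀ f : ℝ → ℝ, cfc f A = U * diagonal (fun i => (f (eigVec A i) : ℂ)) * Uᴴ) ∧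
      ∀ z, matCpow A z = U * diagonal (fun i => zeroCpow (eigVec A i) z) * Uᴴ := by
  obtain ⟨U, h1, h2, h⟩ := exists_unitary_cfc_eq hA
  refine ⟨U, h1, h2, ?_, h, fun z => ?_⟩
  · rw [← h fun x => x]
    exact (cfc_id' ℝ A hA).symm
  · rw [matCpow, h, h, ← Matrix.smul_mul, ← Matrix.mul_smul, ← Matrix.add_mul, ← Matrix.mul_add,
      ← diagonal_smul, diagonal_add]
    congr 3
    ext i
    simp only [Pi.smul_apply, smul_eq_mul]
    rw [mul_comm, Complex.re_add_im]

theorem matCpow_add {m : ℕ} {A : Matrix (Fin m) (Fin m) ℂ} (hA : A.IsHermitian) (z w : ℂ) :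
    matCpow A (z + w) = matCpow A z * matCpow A w := by
  obtain ⟨U, h1, -, -, -, h⟩ := exists_unitary_matCpow_eq hA
  rw [h, h, h]
  calc _ = U * (diagonal (fun i => zeroCpow (eigVec A i) z) *
        diagonal (fun i => zeroCpow (eigVec A i) w)) * Uᴴ := by
        rw [diagonal_mul_diagonal]; simp_rw [zeroCpow_add]
    _ = U * diagonal (fun i => zeroCpow (eigVec A i) z) * (Uᴴ * U) *
        diagonal (fun i => zeroCpow (eigVec A i) w) * Uᴴ := by
        rw [h1]; simp only [mul_one, mul_assoc]
    _ = _ := by simp only [mul_assoc]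

theorem matCpow_ofReal {m : ℕ} {A : Matrix (Fin m) (Fin m) ℂ} (hA : A.PosSemidef) (t : ℝ) :
    matCpow A t = matPow .support A t := by
  obtain ⟨U, -, -, -, hf, h⟩ := exists_unitary_matCpow_eq hA.1
  rw [h, matPow_eq_cfc _ hA, hf]
  simp_rw [zeroCpow_ofReal (eigVec_nonneg hA _)]

theorem matCpow_one {m : ℕ} {A : Matrix (Fin m) (Fin m) ℂ} (hA : A.PosSemidef) :
    matCpow A 1 = A := by
  have := matCpow_ofReal hA 1
  rw [Complex.ofReal_one] at this
  rw [this, matPow_eq_cfc _ hA]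
  simp_rw [scalarPow_one_right]
  exact cfc_id' ℝ A hA.1

theorem commute_matCpow {m : ℕ} {A B : Matrix (Fin m) (Fin m) ℂ} (h : Commute A B) (z w : ℂ) :
    Commute (matCpow A z) (matCpow B w) := by
  have key : ∀ f g : ℝ → ℝ, Commute (cfc f A) (cfc g B) := fun f g =>
    ((h.cfc_real f).symm.cfc_real g).symm
  unfold matCpow
  exact ((key _ _).add_right ((key _ _).smul_right _)).add_left
    (((key _ _).add_right ((key _ _).smul_right _)).smul_left _)

theorem isContraction_matCpow {m : ℕ} {A : Matrix (Fin m) (Fin m) ℂ} (hA : A.IsHermitian) {z : ℂ}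
    (hz : z.re = 0) : IsContraction (matCpow A z) := by
  obtain ⟨U, h1, h2, -, -, h⟩ := exists_unitary_matCpow_eq hA
  rw [h]
  refine .mul (.mul (.of_isometry h1) ?_) (.of_isometry (by rwa [conjTranspose_conjTranspose]))
  unfold IsContraction
  rw [diagonal_conjTranspose, diagonal_mul_diagonal, ← diagonal_one, diagonal_sub]
  refine PosSemidef.diagonal fun i => ?_
  have h3 := norm_zeroCpow_le_one (eigVec A i) hz
  have h4 : star (zeroCpow (eigVec A i) z) * zeroCpow (eigVec A i) z =
      ((‖zeroCpow (eigVec A i) z‖ ^ 2 : ℝ) : ℂ) := by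
    rw [mul_comm]; simp [Complex.mul_conj']
  simp only [Pi.star_apply, Pi.zero_apply]
  rw [h4, sub_nonneg]
  have : ‖zeroCpow (eigVec A i) z‖ ^ 2 ≤ 1 := pow_le_one₀ (norm_nonneg _) h3
  exact_mod_cast this

theorem differentiable_matrix_mul {ι κ l : Type*} [Fintype κ] {M : ℂ → Matrix ι κ ℂ}
    {N : ℂ → Matrix κ l ℂ} (hM : ∀ i j, Differentiable ℂ fun z => M z i j)
    (hN : ∀ i j, Differentiable ℂ fun z => N z i j) (i : ι) (j : l) :
    Differentiable ℂ fun z => (M z * N z) i j := by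
  simp only [Matrix.mul_apply]
  exact Differentiable.fun_sum fun k _ => (hM i k).mul (hN k j)

theorem differentiable_matrix_det {k : ℕ} {M : ℂ → Matrix (Fin k) (Fin k) ℂ}
    (hM : ∀ i j, Differentiable ℂ fun z => M z i j) : Differentiable ℂ fun z => (M z).det := by
  simp only [det_apply']
  exact Differentiable.fun_sum fun σ _ =>
    (Differentiable.fun_finsetProd fun i _ => hM _ _).const_mul _

theorem differentiable_matCpow {m : ℕ} {A : Matrix (Fin m) (Fin m) ℂ} (hA : A.IsHermitian)
    {g : ℂ → ℂ} (hg : Differentiable ℂ g) (i j : Fin m) :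
    Differentiable ℂ fun z => matCpow A (g z) i j := by
  obtain ⟨U, h1, h2, -, -, h⟩ := exists_unitary_matCpow_eq hA
  simp only [h]
  have hD : ∀ a b, Differentiable ℂ fun z =>
      (diagonal (fun i => zeroCpow (eigVec A i) (g z)) : Matrix (Fin m) (Fin m) ℂ) a b := by
    intro a b
    by_cases hab : a = b
    · subst hab
      simp only [diagonal_apply_eq]
      exact (differentiable_zeroCpow (eigVec A a)).comp hg
    · simp [diagonal_apply_ne _ hab]
  exact differentiable_matrix_mul
    (M := fun z => U * diagonal (fun i => zeroCpow (eigVec A i) (g z))) (N := fun _ => Uᴴ)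
    (differentiable_matrix_mul (M := fun _ => U) (fun _ _ => differentiable_const _) hD)
    (fun _ _ => differentiable_const _) i j

/-- Boundedness on the strip, expressed by compactness so that it passes through any continuous
function of several powers. -/
theorem exists_isCompact_matCpow_mem {m : ℕ} {A : Matrix (Fin m) (Fin m) ℂ}
    (hA : A.IsHermitian) :
    ∃ K : Set (Matrix (Fin m) (Fin m) ℂ), IsCompact K ∧
      ∀ z : ℂ, 0 ≤ z.re → z.re ≤ 1 → matCpow A z ∈ K := by
  obtain ⟨U, h1, h2, -, -, h⟩ := exists_unitary_matCpow_eq hA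
  have hK : IsCompact (Set.univ.pi fun i : Fin m =>
      Metric.closedBall (0 : ℂ) (Real.exp |Real.log (eigVec A i)|)) :=
    isCompact_univ_pi fun i => isCompact_closedBall _ _
  have hc : Continuous fun d : Fin m → ℂ => U * diagonal d * Uᴴ :=
    (continuous_const.matrix_mul continuous_id.matrix_diagonal).matrix_mul continuous_const
  refine ⟨_, hK.image hc, fun z hz0 hz1 => ⟨fun i => zeroCpow (eigVec A i) z, ?_, (h z).symm⟩⟩
  intro i _
  simpa using norm_zeroCpow_le _ hz0 hz1

/-! ### Interpolation by the three lines theorem. -/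

section Interpolation

variable {m : ℕ} {A₁ A₂ B₁ B₂ : Matrix (Fin m) (Fin m) ℂ}

/-- The analytic family joining `A₂ * B₂` to `A₁ * B₁`, up to contractive factors on the boundary
of the strip. -/
noncomputable def interpFamily (A₁ A₂ B₁ B₂ : Matrix (Fin m) (Fin m) ℂ) (z : ℂ) :
    Matrix (Fin m) (Fin m) ℂ :=
  matCpow A₁ z * matCpow A₂ (1 - z) * (matCpow B₂ (1 - z) * matCpow B₁ z)

theorem interpFamily_ofReal (hA₁ : A₁.PosSemidef) (hA₂ : A₂.PosSemidef) (hB₁ : B₁.PosSemidef)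
    (hB₂ : B₂.PosSemidef) (hB : Commute B₁ B₂) (θ : ℝ) :
    interpFamily A₁ A₂ B₁ B₂ θ = matPow .support A₁ θ * matPow .support A₂ (1 - θ) *
      (matPow .support B₁ θ * matPow .support B₂ (1 - θ)) := by
  have h : (1 : ℂ) - θ = ((1 - θ : ℝ) : ℂ) := by push_cast; rfl
  unfold interpFamily
  rw [h, matCpow_ofReal hA₁, matCpow_ofReal hA₂, matCpow_ofReal hB₁, matCpow_ofReal hB₂,
    (commute_matPow hB₁ hB₂ hB θ (1 - θ)).eq]

/-- One full factor `A₂` and one full factor `B₂` split off next to each other, because the `B₂`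
power stands to the left of the `B₁` power; what remains on either side is a product of purely
imaginary powers. -/
theorem exists_interpFamily_eq_of_re_eq_zero (hA₁ : A₁.PosSemidef) (hA₂ : A₂.PosSemidef)
    (hB₁ : B₁.PosSemidef) (hB₂ : B₂.PosSemidef) {z : ℂ} (hz : z.re = 0) :
    ∃ C D : Matrix (Fin m) (Fin m) ℂ, IsContraction C ∧ IsContraction D ∧
      interpFamily A₁ A₂ B₁ B₂ z = C * (A₂ * B₂) * D := by
  have hz' : (-z).re = 0 := by simp [hz]
  refine ⟨matCpow A₁ z * matCpow A₂ (-z), matCpow B₂ (-z) * matCpow B₁ z,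
    (isContraction_matCpow hA₁.1 hz).mul (isContraction_matCpow hA₂.1 hz'),
    (isContraction_matCpow hB₂.1 hz').mul (isContraction_matCpow hB₁.1 hz), ?_⟩
  have h1 : matCpow A₂ (1 - z) = matCpow A₂ (-z) * A₂ := by
    rw [sub_eq_neg_add, matCpow_add hA₂.1, matCpow_one hA₂]
  have h2 : matCpow B₂ (1 - z) = B₂ * matCpow B₂ (-z) := by
    rw [sub_eq_add_neg, matCpow_add hB₂.1, matCpow_one hB₂]
  rw [interpFamily, h1, h2]
  simp only [mul_assoc]

theorem exists_interpFamily_eq_of_re_eq_one (hA₁ : A₁.PosSemidef) (hA₂ : A₂.PosSemidef)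
    (hB₁ : B₁.PosSemidef) (hB₂ : B₂.PosSemidef) (hA : Commute A₁ A₂) (hB : Commute B₁ B₂) {z : ℂ}
    (hz : z.re = 1) :
    ∃ C D : Matrix (Fin m) (Fin m) ℂ, IsContraction C ∧ IsContraction D ∧
      interpFamily A₁ A₂ B₁ B₂ z = C * (A₁ * B₁) * D := by
  -- Commutativity makes the family symmetric under exchanging the indices and `z ↔ 1 - z`, which
  -- reduces this edge to the other.
  have h : interpFamily A₁ A₂ B₁ B₂ z = interpFamily A₂ A₁ B₂ B₁ (1 - z) := by
    unfold interpFamily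
    rw [sub_sub_cancel, (commute_matCpow hA z (1 - z)).eq, (commute_matCpow hB z (1 - z)).eq]
  rw [h]
  exact exists_interpFamily_eq_of_re_eq_zero hA₂ hA₁ hB₂ hB₁ (by simp [hz])

theorem norm_det_compression_mul_le {k : ℕ} (hk : k ≤ m) (hk0 : 0 < k)
    {V W : Matrix (Fin m) (Fin k) ℂ} (hV : IsContraction V) (hW : IsContraction W)
    {C D : Matrix (Fin m) (Fin m) ℂ} (hC : IsContraction C) (hD : IsContraction D)
    (X : Matrix (Fin m) (Fin m) ℂ) :
    ‖(Wᴴ * (C * X * D) * V).det‖ ≤ ∏ i, singVec X (Fin.castLE hk i) := by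
  have h : Wᴴ * (C * X * D) * V = (Cᴴ * W)ᴴ * X * (D * V) := by
    simp only [conjTranspose_mul, conjTranspose_conjTranspose, Matrix.mul_assoc]
  rw [h]
  exact norm_det_compression_le hk hk0 (hD.mul hV) (hC.conjTranspose.mul hW) X

theorem differentiable_det_interpFamily (hA₁ : A₁.IsHermitian) (hA₂ : A₂.IsHermitian)
    (hB₁ : B₁.IsHermitian) (hB₂ : B₂.IsHermitian) {k : ℕ} (V W : Matrix (Fin m) (Fin k) ℂ) :
    Differentiable ℂ fun z => (Wᴴ * interpFamily A₁ A₂ B₁ B₂ z * V).det := by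
  have h1 : Differentiable ℂ fun z : ℂ => 1 - z := by fun_prop
  have h2 : Differentiable ℂ fun z : ℂ => z := differentiable_id
  have hF : ∀ i j, Differentiable ℂ fun z => interpFamily A₁ A₂ B₁ B₂ z i j :=
    differentiable_matrix_mul (M := fun z => matCpow A₁ z * matCpow A₂ (1 - z))
      (N := fun z => matCpow B₂ (1 - z) * matCpow B₁ z)
      (differentiable_matrix_mul (differentiable_matCpow hA₁ h2) (differentiable_matCpow hA₂ h1))
      (differentiable_matrix_mul (differentiable_matCpow hB₂ h1) (differentiable_matCpow hB₁ h2))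
  exact differentiable_matrix_det (M := fun z => Wᴴ * interpFamily A₁ A₂ B₁ B₂ z * V)
    (differentiable_matrix_mul (M := fun z => Wᴴ * interpFamily A₁ A₂ B₁ B₂ z) (N := fun _ => V)
      (differentiable_matrix_mul (M := fun _ => Wᴴ) (fun _ _ => differentiable_const _) hF)
      (fun _ _ => differentiable_const _))

theorem bddAbove_norm_det_interpFamily (hA₁ : A₁.IsHermitian) (hA₂ : A₂.IsHermitian)
    (hB₁ : B₁.IsHermitian) (hB₂ : B₂.IsHermitian) {k : ℕ} (V W : Matrix (Fin m) (Fin k) ℂ) :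
    BddAbove ((norm ∘ fun z => (Wᴴ * interpFamily A₁ A₂ B₁ B₂ z * V).det) ''
      Complex.HadamardThreeLines.verticalClosedStrip 0 1) := by
  obtain ⟨K₁, hK₁, h₁⟩ := exists_isCompact_matCpow_mem hA₁
  obtain ⟨K₂, hK₂, h₂⟩ := exists_isCompact_matCpow_mem hA₂
  obtain ⟨L₁, hL₁, h₃⟩ := exists_isCompact_matCpow_mem hB₁
  obtain ⟨L₂, hL₂, h₄⟩ := exists_isCompact_matCpow_mem hB₂
  let Φ : (Matrix (Fin m) (Fin m) ℂ × Matrix (Fin m) (Fin m) ℂ) ×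
      (Matrix (Fin m) (Fin m) ℂ × Matrix (Fin m) (Fin m) ℂ) → ℝ := fun p =>
    ‖(Wᴴ * (p.1.1 * p.1.2 * (p.2.1 * p.2.2)) * V).det‖
  have hΦ : Continuous Φ := by
    refine Continuous.norm (Continuous.matrix_det (Continuous.matrix_mul
      (Continuous.matrix_mul continuous_const ?_) continuous_const))
    fun_prop
  refine (((hK₁.prod hK₂).prod (hL₂.prod hL₁)).image hΦ).bddAbove.mono ?_
  rintro _ ⟨z, hz, rfl⟩
  obtain ⟨hz0, hz1⟩ : 0 ≤ z.re ∧ z.re ≤ 1 := hz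
  have hw0 : 0 ≤ (1 - z).re := by simpa using hz1
  have hw1 : (1 - z).re ≤ 1 := by simpa using hz0
  exact ⟨((matCpow A₁ z, matCpow A₂ (1 - z)), (matCpow B₂ (1 - z), matCpow B₁ z)),
    ⟨⟨h₁ z hz0 hz1, h₂ _ hw0 hw1⟩, ⟨h₄ _ hw0 hw1, h₃ z hz0 hz1⟩⟩, rfl⟩

theorem norm_det_interpFamily_le (hA₁ : A₁.PosSemidef) (hA₂ : A₂.PosSemidef)
    (hB₁ : B₁.PosSemidef) (hB₂ : B₂.PosSemidef) (hA : Commute A₁ A₂) (hB : Commute B₁ B₂)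
    {k : ℕ} (hk : k ≤ m) (hk0 : 0 < k) {V W : Matrix (Fin m) (Fin k) ℂ} (hV : IsContraction V)
    (hW : IsContraction W) {θ : ℝ} (h0 : 0 ≤ θ) (h1 : θ ≤ 1) :
    ‖(Wᴴ * interpFamily A₁ A₂ B₁ B₂ θ * V).det‖ ≤
      (∏ i, singVec (A₂ * B₂) (Fin.castLE hk i)) ^ (1 - θ) *
        (∏ i, singVec (A₁ * B₁) (Fin.castLE hk i)) ^ θ := by
  have := Complex.HadamardThreeLines.norm_le_interp_of_mem_verticalClosedStrip'
    (f := fun z => (Wᴴ * interpFamily A₁ A₂ B₁ B₂ z * V).det) (z := (θ : ℂ)) (l := 0) (u := 1)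
    (a := ∏ i, singVec (A₂ * B₂) (Fin.castLE hk i))
    (b := ∏ i, singVec (A₁ * B₁) (Fin.castLE hk i)) one_pos ⟨by simpa using h0, by simpa using h1⟩
    (differentiable_det_interpFamily hA₁.1 hA₂.1 hB₁.1 hB₂.1 V W).diffContOnCl
    (bddAbove_norm_det_interpFamily hA₁.1 hA₂.1 hB₁.1 hB₂.1 V W) ?_ ?_
  · simpa using this
  · intro z hz
    obtain ⟨C, D, hC, hD, h⟩ := exists_interpFamily_eq_of_re_eq_zero hA₁ hA₂ hB₁ hB₂ hz
    simp only [h]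
    exact norm_det_compression_mul_le hk hk0 hV hW hC hD _
  · intro z hz
    obtain ⟨C, D, hC, hD, h⟩ := exists_interpFamily_eq_of_re_eq_one hA₁ hA₂ hB₁ hB₂ hA hB hz
    simp only [h]
    exact norm_det_compression_mul_le hk hk0 hV hW hC hD _

/-- At `θ = 0` or `1` the three lines bound carries `0 ^ 0 = 1`, too weak for the support
convention. If either product is zero, the determinant vanishes for `0 < t < 1`, hence by continuity
also at the endpoints. -/
theorem norm_det_interpFamily_le_scalarPow (hA₁ : A₁.PosSemidef) (hA₂ : A₂.PosSemidef)
    (hB₁ : B₁.PosSemidef) (hB₂ : B₂.PosSemidef) (hA : Commute A₁ A₂) (hB : Commute B₁ B₂)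
    {k : ℕ} (hk : k ≤ m) (hk0 : 0 < k) {V W : Matrix (Fin m) (Fin k) ℂ} (hV : IsContraction V)
    (hW : IsContraction W) {θ : ℝ} (h0 : 0 ≤ θ) (h1 : θ ≤ 1) :
    ‖(Wᴴ * interpFamily A₁ A₂ B₁ B₂ θ * V).det‖ ≤
      scalarPow .support (∏ i, singVec (A₁ * B₁) (Fin.castLE hk i)) θ *
        scalarPow .support (∏ i, singVec (A₂ * B₂) (Fin.castLE hk i)) (1 - θ) := by
  have key := fun (t : ℝ) (ht0 : 0 ≤ t) (ht1 : t ≤ 1) =>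
    norm_det_interpFamily_le hA₁ hA₂ hB₁ hB₂ hA hB hk hk0 hV hW ht0 ht1
  set a := ∏ i, singVec (A₁ * B₁) (Fin.castLE hk i)
  set b := ∏ i, singVec (A₂ * B₂) (Fin.castLE hk i)
  have hcont : Continuous fun t : ℝ => ‖(Wᴴ * interpFamily A₁ A₂ B₁ B₂ t * V).det‖ :=
    ((differentiable_det_interpFamily hA₁.1 hA₂.1 hB₁.1 hB₂.1 V W).continuous.comp
      Complex.continuous_ofReal).norm
  have hvanish : a = 0 ∨ b = 0 → ∀ t ∈ Set.Icc (0 : ℝ) 1,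
      ‖(Wᴴ * interpFamily A₁ A₂ B₁ B₂ t * V).det‖ ≤ 0 := by
    intro hab
    have hcl : IsClosed {t : ℝ | ‖(Wᴴ * interpFamily A₁ A₂ B₁ B₂ t * V).det‖ ≤ 0} :=
      isClosed_le hcont continuous_const
    have hsub : Set.Ioo (0 : ℝ) 1 ⊆
        {t : ℝ | ‖(Wᴴ * interpFamily A₁ A₂ B₁ B₂ t * V).det‖ ≤ 0} := by
      intro t ht
      refine (key t ht.1.le ht.2.le).trans_eq ?_
      rcases hab with h | h
      · rw [h, Real.zero_rpow ht.1.ne', mul_zero]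
      · rw [h, Real.zero_rpow (sub_pos.mpr ht.2).ne', zero_mul]
    have := closure_minimal hsub hcl
    rwa [closure_Ioo zero_ne_one] at this
  have ha : 0 ≤ a := Finset.prod_nonneg fun i _ => singVec_nonneg _ _
  have hb : 0 ≤ b := Finset.prod_nonneg fun i _ => singVec_nonneg _ _
  by_cases hab : a = 0 ∨ b = 0
  · exact (hvanish hab θ ⟨h0, h1⟩).trans
      (mul_nonneg (scalarPow_nonneg _ ha _) (scalarPow_nonneg _ hb _))
  · rw [not_or] at hab
    simpa [scalarPow, hab.1, hab.2, mul_comm] using key θ h0 h1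

end Interpolation

/-! ### Log-majorization of singular values. -/

theorem det_matPow (c : ZeroPowConvention) {m : ℕ} {A : Matrix (Fin m) (Fin m) ℂ}
    (hA : A.PosSemidef) (t : ℝ) : ‖(matPow c A t).det‖ = scalarPow c ‖A.det‖ t := by
  obtain ⟨U, -, h2, h⟩ := exists_unitary_cfc_eq hA.1
  rw [matPow_eq_cfc c hA, h, det_unitary_conj h2, det_diagonal, det_eq_prod_eigVec hA.1,
    norm_prod, norm_prod, scalarPow_prod c _ fun i => norm_nonneg _]
  refine Finset.prod_congr rfl fun i _ => ?_
  rw [Complex.norm_real, Complex.norm_real, Real.norm_of_nonneg (eigVec_nonneg hA i),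
    Real.norm_of_nonneg (scalarPow_nonneg c (eigVec_nonneg hA i) t)]

theorem prod_singVec_castLE_le (c : ZeroPowConvention) {m : ℕ}
    {A₁ A₂ B₁ B₂ : Matrix (Fin m) (Fin m) ℂ} (hA₁ : A₁.PosSemidef) (hA₂ : A₂.PosSemidef)
    (hB₁ : B₁.PosSemidef) (hB₂ : B₂.PosSemidef) (hA : Commute A₁ A₂) (hB : Commute B₁ B₂)
    {k : ℕ} (hk : k ≤ m) (hk0 : 0 < k) {θ : ℝ} (h0 : 0 ≤ θ) (h1 : θ ≤ 1) :
    ∏ i, singVec (matPow c A₁ θ * matPow c A₂ (1 - θ) *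
        (matPow c B₁ θ * matPow c B₂ (1 - θ))) (Fin.castLE hk i) ≤
      scalarPow c (∏ i, singVec (A₁ * B₁) (Fin.castLE hk i)) θ *
        scalarPow c (∏ i, singVec (A₂ * B₂) (Fin.castLE hk i)) (1 - θ) := by
  have hsupp : ∏ i, singVec (matPow .support A₁ θ * matPow .support A₂ (1 - θ) *
        (matPow .support B₁ θ * matPow .support B₂ (1 - θ))) (Fin.castLE hk i) ≤
      scalarPow .support (∏ i, singVec (A₁ * B₁) (Fin.castLE hk i)) θ *
        scalarPow .support (∏ i, singVec (A₂ * B₂) (Fin.castLE hk i)) (1 - θ) := by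
    rw [← interpFamily_ofReal hA₁ hA₂ hB₁ hB₂ hB]
    obtain ⟨V, W, hV, hW, h⟩ := exists_prod_singVec_le_norm_det_compression hk
      (interpFamily A₁ A₂ B₁ B₂ θ)
    exact h.trans
      (norm_det_interpFamily_le_scalarPow hA₁ hA₂ hB₁ hB₂ hA hB hk hk0 hV hW h0 h1)
  cases c with
  | support => exact hsupp
  | one =>
    -- The conventions agree for `0 < θ < 1`; with zeroth powers equal to `1`, both endpoints are
    -- equalities.
    have hz : ∀ {X : Matrix (Fin m) (Fin m) ℂ}, X.PosSemidef → X ^ (0 : ℝ) = 1 :=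
      fun hX => CFC.rpow_zero _ hX.nonneg
    have ho : ∀ {X : Matrix (Fin m) (Fin m) ℂ}, X.PosSemidef → X ^ (1 : ℝ) = X :=
      fun hX => CFC.rpow_one _ hX.nonneg
    rcases h0.eq_or_lt with rfl | h0
    · simp [matPow, scalarPow, hz hA₁, hz hB₁, ho hA₂, ho hB₂]
    rcases h1.eq_or_lt with rfl | h1
    · simp [matPow, scalarPow, hz hA₂, hz hB₂, ho hA₁, ho hB₁]
    simpa [matPow, scalarPow, h0.ne', (sub_pos.mpr h1).ne'] using hsupp

theorem antitone_scalarPow_mul (c : ZeroPowConvention) {m : ℕ} {a b : Fin m → ℝ}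
    (ha0 : ∀ i, 0 ≤ a i) (hb0 : ∀ i, 0 ≤ b i) (ha : Antitone a) (hb : Antitone b) {θ : ℝ}
    (h0 : 0 ≤ θ) (h1 : θ ≤ 1) :
    Antitone fun i => scalarPow c (a i) θ * scalarPow c (b i) (1 - θ) := fun i j hij =>
  mul_le_mul (scalarPow_monotoneOn c h0 (ha0 j) (ha0 i) (ha hij))
    (scalarPow_monotoneOn c (sub_nonneg.mpr h1) (hb0 j) (hb0 i) (hb hij))
    (scalarPow_nonneg c (hb0 j) _) (scalarPow_nonneg c (ha0 i) _)

theorem logMajorizedBy_singVec (c : ZeroPowConvention) {m : ℕ}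
    {A₁ A₂ B₁ B₂ : Matrix (Fin m) (Fin m) ℂ} (hA₁ : A₁.PosSemidef) (hA₂ : A₂.PosSemidef)
    (hB₁ : B₁.PosSemidef) (hB₂ : B₂.PosSemidef) (hA : Commute A₁ A₂) (hB : Commute B₁ B₂)
    {θ : ℝ} (h0 : 0 ≤ θ) (h1 : θ ≤ 1) :
    LogMajorizedBy
      (singVec (matPow c A₁ θ * matPow c A₂ (1 - θ) * (matPow c B₁ θ * matPow c B₂ (1 - θ))))
      (fun i => scalarPow c (singVec (A₁ * B₁) i) θ *
        scalarPow c (singVec (A₂ * B₂) i) (1 - θ)) where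
  nonneg_left := singVec_nonneg _
  nonneg_right i := mul_nonneg (scalarPow_nonneg c (singVec_nonneg _ i) _)
    (scalarPow_nonneg c (singVec_nonneg _ i) _)
  prod_le k hk1 hkm := by
    rw [decr_eq_self (singVec_antitone _), decr_eq_self (antitone_scalarPow_mul c (singVec_nonneg _)
      (singVec_nonneg _) (singVec_antitone _) (singVec_antitone _) h0 h1),
      ← prod_castLE hkm.le, ← prod_castLE hkm.le, Finset.prod_mul_distrib,
      ← scalarPow_prod c _ fun i => singVec_nonneg _ _,
      ← scalarPow_prod c _ fun i => singVec_nonneg _ _]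
    exact prod_singVec_castLE_le c hA₁ hA₂ hB₁ hB₂ hA hB hkm.le hk1 h0 h1
  prod_eq := by
    rw [prod_singVec, Finset.prod_mul_distrib, ← scalarPow_prod c _ (singVec_nonneg _),
      ← scalarPow_prod c _ (singVec_nonneg _), prod_singVec, prod_singVec]
    simp only [det_mul, norm_mul]
    rw [det_matPow c hA₁, det_matPow c hA₂, det_matPow c hB₁, det_matPow c hB₂,
      scalarPow_mul c (norm_nonneg _) (norm_nonneg _),
      scalarPow_mul c (norm_nonneg _) (norm_nonneg _)]
    ring

/-! ### From singular values to eigenvalues, and Araki's inequality. -/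

theorem posSemidef_rpow {m : ℕ} {A : Matrix (Fin m) (Fin m) ℂ} (t : ℝ) : (A ^ t).PosSemidef :=
  CFC.rpow_nonneg.posSemidef

theorem rpow_half_mul_self {m : ℕ} {A : Matrix (Fin m) (Fin m) ℂ} (hA : A.PosSemidef) :
    A ^ (1 / 2 : ℝ) * A ^ (1 / 2 : ℝ) = A := by
  rw [← CFC.sqrt_eq_rpow]
  exact CFC.sqrt_mul_sqrt_self A hA.nonneg

theorem commute_rpow {m : ℕ} {A B : Matrix (Fin m) (Fin m) ℂ} (hA : A.PosSemidef)
    (hB : B.PosSemidef) (h : Commute A B) (s t : ℝ) : Commute (A ^ s) (B ^ t) :=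
  commute_matPow (c := .one) hA hB h s t

theorem matPow_rpow_half_mul_self (c : ZeroPowConvention) {m : ℕ}
    {A : Matrix (Fin m) (Fin m) ℂ} (hA : A.PosSemidef) (t : ℝ) :
    matPow c (A ^ (1 / 2 : ℝ)) t * matPow c (A ^ (1 / 2 : ℝ)) t = matPow c A t := by
  -- Finiteness of the spectrum matters: the support power with exponent `0` is discontinuous at
  -- `0`.
  have hcont : ∀ (f : ℝ → ℝ) (X : Matrix (Fin m) (Fin m) ℂ), ContinuousOn f (spectrum ℝ X) :=
    fun f X => X.finite_real_spectrum.continuousOn f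
  rw [matPow_eq_cfc c (posSemidef_rpow _), matPow_eq_cfc c hA,
    ← cfc_mul _ _ _ (hcont _ _) (hcont _ _), CFC.rpow_eq_cfc_real hA.nonneg]
  refine (cfc_comp' (fun x => scalarPow c x t * scalarPow c x t) (fun x : ℝ => x ^ (1 / 2 : ℝ)) A
    ((A.finite_real_spectrum.image _).continuousOn _) (hcont _ _) hA.1).symm.trans ?_
  refine cfc_congr fun x hx => ?_
  have hx0 : 0 ≤ x := spectrum_nonneg_of_nonneg hA.nonneg hx
  have hs : (0 : ℝ) ≤ x ^ (1 / 2 : ℝ) := Real.rpow_nonneg hx0 _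
  rw [← scalarPow_mul c hs hs, ← Real.sqrt_eq_rpow, Real.mul_self_sqrt hx0]

theorem rpow_half_matPow_mul_matPow (c : ZeroPowConvention) {m : ℕ}
    {A₁ A₂ : Matrix (Fin m) (Fin m) ℂ} (hA₁ : A₁.PosSemidef) (hA₂ : A₂.PosSemidef)
    (hA : Commute A₁ A₂) (s t : ℝ) :
    (matPow c (A₁ ^ (1 / 2 : ℝ)) s * matPow c (A₂ ^ (1 / 2 : ℝ)) t) *
      (matPow c (A₁ ^ (1 / 2 : ℝ)) s * matPow c (A₂ ^ (1 / 2 : ℝ)) t) =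
      matPow c A₁ s * matPow c A₂ t := by
  have h := commute_matPow (c := c) (posSemidef_rpow _) (posSemidef_rpow _)
    (commute_rpow hA₁ hA₂ hA (1 / 2) (1 / 2)) s t
  rw [h.symm.mul_mul_mul_comm, matPow_rpow_half_mul_self c hA₁, matPow_rpow_half_mul_self c hA₂]

theorem eigVec_mul_mul_self {m : ℕ} {R N : Matrix (Fin m) (Fin m) ℂ} (hR : R.IsHermitian)
    (hN : N.IsHermitian) : eigVec (R * (N * N) * R) = fun i => singVec (N * R) i ^ 2 := by
  ext i
  rw [sq_singVec, conjTranspose_mul, hR.eq, hN.eq]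
  simp only [mul_assoc]

theorem LogMajorizedBy.sq {m : ℕ} {a b : Fin m → ℝ} (h : LogMajorizedBy a b) (ha : Antitone a)
    (hb : Antitone b) : LogMajorizedBy (fun i => a i ^ 2) (fun i => b i ^ 2) where
  nonneg_left i := sq_nonneg _
  nonneg_right i := sq_nonneg _
  prod_le k hk1 hkm := by
    have h1 := h.prod_le k hk1 hkm
    rw [decr_eq_self ha, decr_eq_self hb] at h1
    rw [decr_eq_self fun i j hij => pow_le_pow_left₀ (h.nonneg_left j) (ha hij) 2,
      decr_eq_self fun i j hij => pow_le_pow_left₀ (h.nonneg_right j) (hb hij) 2,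
      Finset.prod_pow, Finset.prod_pow]
    exact pow_le_pow_left₀ (Finset.prod_nonneg fun i _ => h.nonneg_left i) h1 2
  prod_eq := by rw [Finset.prod_pow, Finset.prod_pow, h.prod_eq]

theorem logMajorizedBy_eigVec (c : ZeroPowConvention) {m : ℕ}
    {A₁ A₂ B₁ B₂ : Matrix (Fin m) (Fin m) ℂ} (hA₁ : A₁.PosSemidef) (hA₂ : A₂.PosSemidef)
    (hB₁ : B₁.PosSemidef) (hB₂ : B₂.PosSemidef) (hA : Commute A₁ A₂) (hB : Commute B₁ B₂)
    {θ : ℝ} (h0 : 0 ≤ θ) (h1 : θ ≤ 1) :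
    LogMajorizedBy
      (eigVec ((matPow c A₁ θ * matPow c A₂ (1 - θ)) ^ (1 / 2 : ℝ) *
        (matPow c B₁ θ * matPow c B₂ (1 - θ)) *
        (matPow c A₁ θ * matPow c A₂ (1 - θ)) ^ (1 / 2 : ℝ)))
      (fun i => scalarPow c (eigVec (A₁ ^ (1 / 2 : ℝ) * B₁ * A₁ ^ (1 / 2 : ℝ)) i) θ *
        scalarPow c (eigVec (A₂ ^ (1 / 2 : ℝ) * B₂ * A₂ ^ (1 / 2 : ℝ)) i) (1 - θ)) := by
  have hA' := commute_rpow hA₁ hA₂ hA (1 / 2) (1 / 2)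
  have hB' := commute_rpow hB₁ hB₂ hB (1 / 2) (1 / 2)
  -- The roles of `A` and `B` are exchanged, since `λ(R N² R) = s(N R)²` has the root of the `B`
  -- part on the left.
  have hlog := logMajorizedBy_singVec c (posSemidef_rpow _) (posSemidef_rpow _)
    (posSemidef_rpow _) (posSemidef_rpow _) hB' hA' h0 h1
  have hR := posSemidef_matPow_mul_matPow (c := c) (posSemidef_rpow _) (posSemidef_rpow _) hA'
    θ (1 - θ)
  have hN := posSemidef_matPow_mul_matPow (c := c) (posSemidef_rpow _) (posSemidef_rpow _) hB'
    θ (1 - θ)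
  have hRR := rpow_half_matPow_mul_matPow c hA₁ hA₂ hA θ (1 - θ)
  have hNN := rpow_half_matPow_mul_matPow c hB₁ hB₂ hB θ (1 - θ)
  have hroot : (matPow c A₁ θ * matPow c A₂ (1 - θ)) ^ (1 / 2 : ℝ) =
      matPow c (A₁ ^ (1 / 2 : ℝ)) θ * matPow c (A₂ ^ (1 / 2 : ℝ)) (1 - θ) := by
    -- The product of the powers of the square roots is positive semidefinite with the right square,
    -- so uniqueness identifies it as the square root.
    rw [← CFC.sqrt_eq_rpow]
    exact CFC.sqrt_unique hRR hR.nonneg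
  have hfactor : ∀ {A B : Matrix (Fin m) (Fin m) ℂ}, B.PosSemidef →
      eigVec (A ^ (1 / 2 : ℝ) * B * A ^ (1 / 2 : ℝ)) =
        fun i => singVec (B ^ (1 / 2 : ℝ) * A ^ (1 / 2 : ℝ)) i ^ 2 := by
    intro A B hB
    rw [← eigVec_mul_mul_self (posSemidef_rpow _).1 (posSemidef_rpow _).1, rpow_half_mul_self hB]
  rw [hroot, ← hNN, eigVec_mul_mul_self hR.1 hN.1, hfactor hB₁, hfactor hB₂]
  have hsq := hlog.sq (singVec_antitone _) (antitone_scalarPow_mul c (singVec_nonneg _)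
    (singVec_nonneg _) (singVec_antitone _) (singVec_antitone _) h0 h1)
  have hpow : ∀ {x : ℝ}, 0 ≤ x → ∀ t, scalarPow c (x ^ 2) t = scalarPow c x t ^ 2 :=
    fun hx t => by rw [sq, sq, scalarPow_mul c hx hx]
  simp only [hpow (singVec_nonneg _ _), ← mul_pow]
  exact hsq

theorem eigVec_one {m : ℕ} : eigVec (1 : Matrix (Fin m) (Fin m) ℂ) = fun _ => 1 :=
  eigVec_eq_of_unitary_conj (U := 1) antitone_const (by simp) (by simp)

theorem logMajorizedBy_eigVec_rpow {m : ℕ} {A B : Matrix (Fin m) (Fin m) ℂ} (hA : A.PosSemidef)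
    (hB : B.PosSemidef) {p : ℝ} (h0 : 0 ≤ p) (h1 : p ≤ 1) :
    LogMajorizedBy (eigVec (A ^ (p / 2) * B ^ p * A ^ (p / 2)))
      (eigVec ((A ^ (1 / 2 : ℝ) * B * A ^ (1 / 2 : ℝ)) ^ p)) := by
  have h := logMajorizedBy_eigVec .one hA PosSemidef.one hB PosSemidef.one (Commute.one_right A)
    (Commute.one_right B) h0 h1
  have hX : (A ^ (1 / 2 : ℝ) * B * A ^ (1 / 2 : ℝ)).PosSemidef := by
    have := hB.conjTranspose_mul_mul_same (A ^ (1 / 2 : ℝ))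
    rwa [(posSemidef_rpow (A := A) (1 / 2)).1.eq] at this
  have hr : eigVec ((A ^ (1 / 2 : ℝ) * B * A ^ (1 / 2 : ℝ)) ^ p) =
      fun i => eigVec (A ^ (1 / 2 : ℝ) * B * A ^ (1 / 2 : ℝ)) i ^ p := by
    have := eigVec_cfc hX (scalarPow_monotoneOn .one h0)
    rwa [← matPow_eq_cfc .one hX] at this
  have hp : (A ^ p) ^ (1 / 2 : ℝ) = A ^ (p / 2) := by
    rw [CFC.rpow_rpow_of_exponent_nonneg A p (1 / 2) h0 (by norm_num) hA.nonneg]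
    congr 1
    ring
  have hone : ∀ t : ℝ, (1 : Matrix (Fin m) (Fin m) ℂ) ^ t = 1 := fun t => CFC.one_rpow
  simp only [matPow, scalarPow, hone, mul_one, hp, eigVec_one, Real.one_rpow] at h
  rw [hr]
  exact h

theorem theorem2p1 (m : ℕ) :
    (∀ (c : ZeroPowConvention) (A₁ A₂ B₁ B₂ : Matrix (Fin m) (Fin m) ℂ),
      A₁.PosSemidef → A₂.PosSemidef → B₁.PosSemidef → B₂.PosSemidef →
      A₁ * A₂ = A₂ * A₁ → B₁ * B₂ = B₂ * B₁ →
      ∀ θ : ℝ, 0 ≤ θ → θ ≤ 1 →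
        (matPow c A₁ θ * matPow c A₂ (1 - θ)).PosSemidef ∧
        (matPow c B₁ θ * matPow c B₂ (1 - θ)).PosSemidef ∧
        LogMajorizedBy
          (eigVec ((matPow c A₁ θ * matPow c A₂ (1 - θ)) ^ (1 / 2 : ℝ) *
            (matPow c B₁ θ * matPow c B₂ (1 - θ)) *
            (matPow c A₁ θ * matPow c A₂ (1 - θ)) ^ (1 / 2 : ℝ)))
          (fun i => scalarPow c (eigVec (A₁ ^ (1 / 2 : ℝ) * B₁ * A₁ ^ (1 / 2 : ℝ)) i) θ *
            scalarPow c (eigVec (A₂ ^ (1 / 2 : ℝ) * B₂ * A₂ ^ (1 / 2 : ℝ)) i) (1 - θ)) ∧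
        LogMajorizedBy
          (singVec ((matPow c A₁ θ * matPow c A₂ (1 - θ)) *
            (matPow c B₁ θ * matPow c B₂ (1 - θ))))
          (fun i => scalarPow c (singVec (A₁ * B₁) i) θ *
            scalarPow c (singVec (A₂ * B₂) i) (1 - θ))) ∧
    (∀ A B : Matrix (Fin m) (Fin m) ℂ, A.PosSemidef → B.PosSemidef →
      ∀ p : ℝ, 0 < p → p ≤ 1 →
        LogMajorizedBy
          (eigVec (A ^ (p / 2) * B ^ p * A ^ (p / 2)))
          (eigVec ((A ^ (1 / 2 : ℝ) * B * A ^ (1 / 2 : ℝ)) ^ p))) := by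
  refine ⟨fun c A₁ A₂ B₁ B₂ hA₁ hA₂ hB₁ hB₂ hA hB θ h0 h1 => ⟨?_, ?_, ?_, ?_⟩,
    fun A B hA hB p h0 h1 => logMajorizedBy_eigVec_rpow hA hB h0.le h1⟩
  · exact posSemidef_matPow_mul_matPow hA₁ hA₂ hA θ (1 - θ)
  · exact posSemidef_matPow_mul_matPow hB₁ hB₂ hB θ (1 - θ)
  · exact logMajorizedBy_eigVec c hA₁ hA₂ hB₁ hB₂ hA hB h0 h1
  · exact logMajorizedBy_singVec c hA₁ hA₂ hB₁ hB₂ hA hB h0 h1
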